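/- Let $n\ge 2$. For an open set $\mathcal O\subset\mathbb R^n$ identify $T\mathcal O$ with $\mathcal O\times\mathbb R^n$. A $C^2$ $1$-density on $\mathcal O$ is a continuous function $L:\mathcal O\times\mathbb R^n\to\mathbb R$ that is $C^2$ on $\mathcal O\times(\mathbb R^n\setminus\{0\})$ and satisfies $L(x,\lambda v)=\lambda L(x,v)$ for all $\lambda\ge 0$. A $C^2$ Finsler metric on $\mathcal O$ is a continuous function $F:\mathcal O\times\mathbb R^n\to[0,\infty)$ that is $C^2$ on $\mathcal O\times(\mathbb R^n\setminus\{0\})$ and such that for every $x\in\mathcal O$ the function $N=F(x,\cdot)$ is a Minkowski norm: $N(v)=0$ if and only if $v=0$; $N(\lambda v)=\lambda N(v)$ for $\lambda>0$; $N(v+w)\le N(v)+N(w)$; and the Hessian of $N^2$ is positive definite at every $v\ne0$. A $C^2$ $1$-density or Finsler metric $L$ on $\mathcal O$ is projective if every parametrized line $t\mapsto x+tv$ with $v\neq 0$ solves the Euler--Lagrange equations $\frac{d}{dt}\frac{\partial L}{\partial v}-\frac{\partial L}{\partial x}=0$ at all times $t$ at which it lies in $\mathcal O$. (1) If $L$ is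 a $C^2$ projective $1$-density on $\mathbb R^n$ and there is a compact set $K\subset\mathbb R^n$ such that $L(x,v)=0$ for all $x\notin K$ and all $v$, then there is a $C^3$ function $f:\mathbb R^n\to\mathbb R$ with $L(x,v)=df(x)\cdot v$ for all $x,v\in\mathbb R^n$. (2) If $F_1$ and $F_2$ are $C^2$ projective Finsler metrics on an open convex set $\mathcal O\subset\mathbb R^n$ and there is a compact set $K\subset\mathcal O$ such that $F_1(x,v)=F_2(x,v)$ for all $x\in\mathcal O\setminus K$ and all $v$, then there is a $C^3$ function $f:\mathcal O\to\mathbb R$ with $F_1(x,v)-F_2(x,v)=df(x)\cdot v$ for all $x\in\mathcal O$ and $v\in\mathbb R^n$. -/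

import Mathlib

/-!
Tangent vectors of an open set `O` of a normed space `E` are written as pairs `(x, v)`, with base
point `x ∈ O` and direction `v : E`; a function on the tangent bundle of `O` is a function
`L : E → E → ℝ` of which only the values `L x v` with `x ∈ O` matter.
-/

/-- A (possibly asymmetric) Minkowski norm: nonnegative, vanishing only at the origin, positively
homogeneous, subadditive, of class `C^2` outside the origin, and such that the Hessian of its
square is positive definite outside the origin. -/
structure IsMinkowskiNorm {V : Type*} [NormedAddCommGroup V] [NormedSpace ℝ V]
    (N : V → ℝ) : Prop where
  nonneg : ∀ v, 0 ≤ N v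
  contDiffOn : ContDiffOn ℝ 2 N {0}ᶜ
  eq_zero_iff : ∀ v, N v = 0 ↔ v = 0
  homogeneous : ∀ (c : ℝ) (v : V), 0 < c → N (c • v) = c * N v
  triangle : ∀ v w, N (v + w) ≤ N v + N w
  hessian_pos : ∀ v, v ≠ 0 → ∀ u, u ≠ 0 →
    0 < fderiv ℝ (fderiv ℝ (fun w => N w ^ 2)) v u u

/-- A `C^k` Finsler metric on the open set `O`: a continuous nonnegative function on the tangent
bundle of `O`, of class `C^k` outside the zero section, whose restriction to every tangent space
is a Minkowski norm. -/
structure IsFinslerMetricOn {E : Type*} [NormedAddCommGroup E] [NormedSpace ℝ E]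
    (k : WithTop ℕ∞) (O : Set E) (F : E → E → ℝ) : Prop where
  continuousOn : ContinuousOn (fun p : E × E => F p.1 p.2) (O ×ˢ Set.univ)
  contDiffOn : ContDiffOn ℝ k (fun p : E × E => F p.1 p.2) (O ×ˢ {0}ᶜ)
  isMinkowskiNorm : ∀ x ∈ O, IsMinkowskiNorm (F x)

/-- A differential `1`-density of class `C^k` on the open set `O`: a continuous function on the
tangent bundle of `O` that is positively homogeneous of degree one in the direction and of class
`C^k` outside the zero section. -/
structure IsOneDensityOn {E : Type*} [NormedAddCommGroup E] [NormedSpace ℝ E]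
    (k : WithTop ℕ∞) (O : Set E) (L : E → E → ℝ) : Prop where
  continuousOn : ContinuousOn (fun p : E × E => L p.1 p.2) (O ×ˢ Set.univ)
  contDiffOn : ContDiffOn ℝ k (fun p : E × E => L p.1 p.2) (O ×ˢ {0}ᶜ)
  homogeneous : ∀ x ∈ O, ∀ (c : ℝ) (v : E), 0 ≤ c → L x (c • v) = c * L x v

/-- A Lagrangian `L` (a `1`-density or a Finsler metric) on `O` is projective when every
parametrized line `t ↦ x + t v`, `v ≠ 0`, solves, for all times at which it lies in `O`, the
Euler-Lagrange equations `d/dt (∂L/∂v) - ∂L/∂x = 0`. -/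
def IsProjectiveOn {E : Type*} [NormedAddCommGroup E] [NormedSpace ℝ E]
    (O : Set E) (L : E → E → ℝ) : Prop :=
  ∀ x v : E, v ≠ 0 → ∀ t : ℝ, x + t • v ∈ O →
    HasDerivAt (fun s : ℝ => fderiv ℝ (fun w => L (x + s • v) w) v)
      (fderiv ℝ (fun y => L y v) (x + t • v)) t

/-- `L` is, on the tangent bundle of the open set `O`, the differential of a `C^3` function. -/
def IsDifferentialOfC3On {E : Type*} [NormedAddCommGroup E] [NormedSpace ℝ E]
    (O : Set E) (L : E → E → ℝ) : Prop :=
  ∃ f : E → ℝ, ContDiffOn ℝ 3 f O ∧ ∀ x ∈ O, ∀ v, L x v = fderiv ℝ f x v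

/-! Let `S(x, y)` be the action of `L` along the segment from `x` to `y`. Lines being extremals, the
first variation of `S` at `x ≠ y` is `∂L/∂v(y, y - x) dy - ∂L/∂v(x, y - x) dx`
(`IsProjectiveOn.hasFDerivAt_segmentAction`). When `x` lies outside a ball supporting `L`, the
second term vanishes. The exterior of a ball is connected in dimension at least two, so `S(x, y)` is
the same for all distant `x` and defines a function `f(y)`, with `df(y) = ∂L/∂v(y, y - x)` for every
distant `x`. Taking `x = y - c v` with `c` large, Euler's identity for homogeneous functions gives
`df(y) v = L(y, v)`. For Finsler metrics, the difference is a projective density vanishing off `K`;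
its extension by zero reduces the second claim to the first. -/

/-- The affine segment map `p ↦ (p.1 + t (p.2 - p.1), p.2 - p.1)` as a continuous linear map. -/
noncomputable def segmentMap (E : Type*) [NormedAddCommGroup E] [NormedSpace ℝ E] (t : ℝ) :
    E × E →L[ℝ] E × E :=
  (ContinuousLinearMap.fst ℝ E E
    + t • (ContinuousLinearMap.snd ℝ E E - ContinuousLinearMap.fst ℝ E E)).prod
    (ContinuousLinearMap.snd ℝ E E - ContinuousLinearMap.fst ℝ E E)

/-- The action of the Lagrangian `L` along the segment from `x` to `y`, run in unit time. -/
noncomputable def segmentAction {E : Type*} [NormedAddCommGroup E] [NormedSpace ℝ E]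
    (L : E → E → ℝ) (x y : E) : ℝ :=
  ∫ t in (0 : ℝ)..1, L (x + t • (y - x)) (y - x)

theorem isOpen_snd_ne_zero {E : Type*} [NormedAddCommGroup E] : IsOpen {q : E × E | q.2 ≠ 0} :=
  isOpen_ne_fun continuous_snd continuous_const

/-! ### First variation of the action along segments -/

section Segment

variable {E : Type*} [NormedAddCommGroup E] [NormedSpace ℝ E]

@[simp]
theorem segmentMap_apply (t : ℝ) (p : E × E) :
    segmentMap E t p = (p.1 + t • (p.2 - p.1), p.2 - p.1) := rfl

theorem continuous_segmentMap : Continuous (segmentMap E) := by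
  have h : segmentMap E = fun t =>
      (ContinuousLinearMap.inl ℝ E E).comp (ContinuousLinearMap.fst ℝ E E
        + t • (ContinuousLinearMap.snd ℝ E E - ContinuousLinearMap.fst ℝ E E))
      + (ContinuousLinearMap.inr ℝ E E).comp
        (ContinuousLinearMap.snd ℝ E E - ContinuousLinearMap.fst ℝ E E) := by
    funext t
    ext p <;> simp
  rw [h]
  refine Continuous.add ?_ continuous_const
  exact continuous_const.clm_comp (continuous_const.add (continuous_id.smul continuous_const))

/-- Differentiation under the integral sign. Distinct endpoints keep the direction away from the
zero section, and compactness of a small closed ball times `[0, 1]` gives the dominating constant.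
-/
theorem hasFDerivAt_integral_comp_segmentMap [ProperSpace E] {g : E × E → ℝ}
    (hg : ContDiffOn ℝ 1 g {q | q.2 ≠ 0}) {p : E × E} (hp : p.1 ≠ p.2) :
    HasFDerivAt (fun q : E × E => ∫ t in (0 : ℝ)..1, g (segmentMap E t q))
      (∫ t in (0 : ℝ)..1, (fderiv ℝ g (segmentMap E t p)).comp (segmentMap E t)) p := by
  have hU : IsOpen {q : E × E | q.1 ≠ q.2} := isOpen_ne_fun continuous_fst continuous_snd
  have hmaps : ∀ (t : ℝ) (q : E × E), q.1 ≠ q.2 → segmentMap E t q ∈ {q : E × E | q.2 ≠ 0} :=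
    fun t q hq => sub_ne_zero.2 (Ne.symm hq)
  have hcont : Continuous fun z : (E × E) × ℝ => segmentMap E z.2 z.1 :=
    (continuous_segmentMap.comp continuous_snd).clm_apply continuous_fst
  have hdg : ContinuousOn (fderiv ℝ g) {q | q.2 ≠ 0} :=
    hg.continuousOn_fderiv_of_isOpen isOpen_snd_ne_zero le_rfl
  have hD : ContinuousOn
      (fun z : (E × E) × ℝ => (fderiv ℝ g (segmentMap E z.2 z.1)).comp (segmentMap E z.2))
      ({q | q.1 ≠ q.2} ×ˢ Set.univ) := by
    refine ContinuousOn.clm_comp ?_ (continuous_segmentMap.comp continuous_snd).continuousOn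
    exact hdg.comp hcont.continuousOn fun z hz => hmaps _ _ hz.1
  have hF : ∀ q : E × E, q.1 ≠ q.2 → Continuous fun t : ℝ => g (segmentMap E t q) := by
    intro q hq
    refine hg.continuousOn.comp_continuous ?_ fun t => hmaps t q hq
    exact continuous_segmentMap.clm_apply continuous_const
  have hF' : Continuous fun t : ℝ => (fderiv ℝ g (segmentMap E t p)).comp (segmentMap E t) :=
    hD.comp_continuous (f := fun t : ℝ => (p, t)) (by fun_prop) fun t => ⟨hp, trivial⟩
  obtain ⟨ε, hε, hball⟩ := Metric.nhds_basis_closedBall.mem_iff.1 (hU.mem_nhds hp)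
  obtain ⟨C, hC⟩ := ((isCompact_closedBall p ε).prod (isCompact_Icc (a := (0 : ℝ)) (b := 1))
    ).exists_bound_of_continuousOn (hD.mono (Set.prod_mono hball (Set.subset_univ _)))
  refine (intervalIntegral.hasFDerivAt_integral_of_dominated_of_fderiv_le
    (F := fun q t => g (segmentMap E t q))
    (F' := fun q t => (fderiv ℝ g (segmentMap E t q)).comp (segmentMap E t))
    (bound := fun _ => C) (Metric.closedBall_mem_nhds p hε) ?_ ?_ ?_ ?_ ?_ ?_)
  · filter_upwards [hU.mem_nhds hp] with q hq using (hF q hq).aestronglyMeasurable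
  · exact (hF p hp).intervalIntegrable _ _
  · exact hF'.aestronglyMeasurable
  · refine Filter.Eventually.of_forall fun t ht q hq => hC (q, t) ⟨hq, ?_⟩
    rw [Set.uIoc_of_le zero_le_one] at ht
    exact ⟨ht.1.le, ht.2⟩
  · exact intervalIntegrable_const
  · refine Filter.Eventually.of_forall fun t _ q hq => ?_
    have h := ((hg.contDiffAt (isOpen_snd_ne_zero.mem_nhds (hmaps t q (hball hq)))
      ).differentiableAt one_ne_zero).hasFDerivAt
    exact h.comp q (segmentMap E t).hasFDerivAt

theorem fderiv_uncurry_apply {L : E → E → ℝ} {x v : E}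
    (h : DifferentiableAt ℝ (fun p : E × E => L p.1 p.2) (x, v)) (a b : E) :
    fderiv ℝ (fun p : E × E => L p.1 p.2) (x, v) (a, b)
      = fderiv ℝ (fun y => L y v) x a + fderiv ℝ (L x) v b := by
  have h₁ : HasFDerivAt (fun y => L y v) _ x :=
    h.hasFDerivAt.comp (f := fun y => (y, v)) x (hasFDerivAt_prodMk_left x v)
  have h₂ : HasFDerivAt (L x) _ v :=
    h.hasFDerivAt.comp (f := fun w => (x, w)) v (hasFDerivAt_prodMk_right x v)
  rw [h₁.fderiv, h₂.fderiv]
  simp [← map_add]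

/-- First variation formula: lines being extremals, only the boundary terms remain. -/
theorem IsProjectiveOn.hasFDerivAt_segmentAction [ProperSpace E] {L : E → E → ℝ}
    (hL : ContDiffOn ℝ 1 (fun p : E × E => L p.1 p.2) {q | q.2 ≠ 0})
    (hproj : IsProjectiveOn Set.univ L) {p : E × E} (hp : p.1 ≠ p.2) :
    HasFDerivAt (fun q : E × E => segmentAction L q.1 q.2)
      ((fderiv ℝ (L p.2) (p.2 - p.1)).comp (ContinuousLinearMap.snd ℝ E E)
        - (fderiv ℝ (L p.1) (p.2 - p.1)).comp (ContinuousLinearMap.fst ℝ E E)) p := by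
  have hw : p.2 - p.1 ≠ 0 := sub_ne_zero.2 (Ne.symm hp)
  have hdiff : ∀ x v : E, v ≠ 0 → DifferentiableAt ℝ (fun p : E × E => L p.1 p.2) (x, v) :=
    fun x v hv => (hL.contDiffAt (isOpen_snd_ne_zero.mem_nhds hv)).differentiableAt one_ne_zero
  have hcont : Continuous fun t : ℝ =>
      (fderiv ℝ (fun q : E × E => L q.1 q.2) (segmentMap E t p)).comp (segmentMap E t) := by
    refine Continuous.clm_comp ?_ continuous_segmentMap
    exact (hL.continuousOn_fderiv_of_isOpen isOpen_snd_ne_zero le_rfl).comp_continuous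
      (continuous_segmentMap.clm_apply continuous_const) fun t => hw
  refine (hasFDerivAt_integral_comp_segmentMap hL hp).congr_fderiv
    (ContinuousLinearMap.ext fun z => ?_)
  rw [ContinuousLinearMap.intervalIntegral_apply (hcont.intervalIntegrable _ _)]
  -- By Euler-Lagrange, the integrand is the total derivative of `∂L/∂v` paired with the variation
  -- field `z.1 + s (z.2 - z.1)`.
  have hderiv : ∀ t : ℝ, HasDerivAt
      (fun s : ℝ => fderiv ℝ (L (p.1 + s • (p.2 - p.1))) (p.2 - p.1) (z.1 + s • (z.2 - z.1)))
      (((fderiv ℝ (fun q : E × E => L q.1 q.2) (segmentMap E t p)).comp (segmentMap E t)) z) t := by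
    intro t
    have h₁ := hproj p.1 (p.2 - p.1) hw t trivial
    have h₂ : HasDerivAt (fun s : ℝ => z.1 + s • (z.2 - z.1)) ((1 : ℝ) • (z.2 - z.1)) t :=
      ((hasDerivAt_id t).smul_const _).const_add _
    refine (h₁.clm_apply h₂).congr_deriv ?_
    rw [one_smul]
    exact (fderiv_uncurry_apply (hdiff _ _ hw) _ _).symm
  rw [intervalIntegral.integral_eq_sub_of_hasDerivAt (fun t _ => hderiv t)
    ((hcont.clm_apply continuous_const).intervalIntegrable _ _)]
  simp

/-! ### Compactly supported densities on the whole space -/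

/-- Pushing each nonzero vector outward by `r` along its ray maps the connected punctured space onto
the exterior of the ball. -/
theorem isPreconnected_setOf_lt_norm (h : 1 < Module.rank ℝ E) {r : ℝ} (hr : 0 ≤ r) :
    IsPreconnected {x : E | r < ‖x‖} := by
  have himage : (fun x : E => (1 + r / ‖x‖) • x) '' {0}ᶜ = {x : E | r < ‖x‖} := by
    ext y
    simp only [Set.mem_image, Set.mem_compl_iff, Set.mem_singleton_iff, Set.mem_ofPred_eq]
    constructor
    · rintro ⟨x, hx, rfl⟩
      have hx' : 0 < ‖x‖ := norm_pos_iff.2 hx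
      rw [norm_smul, Real.norm_of_nonneg (by positivity)]
      field_simp
      linarith
    · intro hy
      have hy' : 0 < ‖y‖ := hr.trans_lt hy
      have hpos : 0 < 1 - r / ‖y‖ := by
        rw [sub_pos, div_lt_one hy']
        exact hy
      refine ⟨(1 - r / ‖y‖) • y, smul_ne_zero hpos.ne' (norm_pos_iff.1 hy'), ?_⟩
      have hne : ‖y‖ - r ≠ 0 := (sub_pos.2 hy).ne'
      rw [norm_smul, Real.norm_of_nonneg hpos.le, smul_smul]
      convert one_smul ℝ y
      field_simp
      ring
  rw [← himage]
  refine (isConnected_compl_singleton_of_one_lt_rank h (0 : E)).isPreconnected.image _ ?_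
  refine ContinuousOn.smul (continuousOn_const.add
    (continuousOn_const.div continuous_norm.continuousOn fun x hx => ?_)) continuousOn_id
  exact norm_ne_zero_iff.2 hx

/-- A projective density vanishing outside a ball is the differential of its action along the
segments issuing from any distant point. -/
theorem IsOneDensityOn.isDifferentialOfC3On_univ [FiniteDimensional ℝ E]
    (hrank : 1 < Module.rank ℝ E) {L : E → E → ℝ} (hL : IsOneDensityOn 2 Set.univ L)
    (hproj : IsProjectiveOn Set.univ L) {R : ℝ} (hR : 0 ≤ R)
    (hsupp : ∀ x, R < ‖x‖ → ∀ v, L x v = 0) :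
    IsDifferentialOfC3On Set.univ L := by
  have : ProperSpace E := FiniteDimensional.proper_real E
  have : Nontrivial E := rank_pos_iff_nontrivial.1 (zero_lt_one.trans hrank)
  have hset : (Set.univ ×ˢ {0}ᶜ : Set (E × E)) = {q | q.2 ≠ 0} := by
    ext q
    simp
  have hC2 : ContDiffOn ℝ 2 (fun p : E × E => L p.1 p.2) {q | q.2 ≠ 0} := hset ▸ hL.contDiffOn
  have hvar := fun {p : E × E} (hp : p.1 ≠ p.2) =>
    hproj.hasFDerivAt_segmentAction (hC2.of_le one_le_two) hp
  have hconst : ∀ y x₁ x₂ : E, max R ‖y‖ < ‖x₁‖ → max R ‖y‖ < ‖x₂‖ →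
      segmentAction L x₁ y = segmentAction L x₂ y := by
    intro y x₁ x₂ h₁ h₂
    have hd : ∀ x : E, max R ‖y‖ < ‖x‖ →
        HasFDerivAt (fun x => segmentAction L x y) (0 : E →L[ℝ] ℝ) x := by
      intro x hx
      have hne : x ≠ y := by
        rintro rfl
        exact (le_max_right _ _).not_gt hx
      have hzero : L x = fun _ => 0 := funext (hsupp x ((le_max_left _ _).trans_lt hx))
      have h : HasFDerivAt (fun x => segmentAction L x y) _ x :=
        (hvar (p := (x, y)) hne).comp (f := fun x => (x, y)) x (hasFDerivAt_prodMk_left x y)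
      refine h.congr_fderiv (ContinuousLinearMap.ext fun a => ?_)
      simp [hzero]
    refine IsOpen.is_const_of_fderiv_eq_zero (𝕜 := ℝ) (s := {x : E | max R ‖y‖ < ‖x‖})
      (isOpen_lt continuous_const continuous_norm)
      (isPreconnected_setOf_lt_norm hrank (hR.trans (le_max_left _ _)))
      (fun x hx => (hd x hx).differentiableAt.differentiableWithinAt)
      (fun x hx => (hd x hx).fderiv) h₁ h₂
  -- The choice need not be continuous in `y`: by `hconst` the action does not depend on it.
  choose far hfar using fun y : E => NormedSpace.exists_lt_norm ℝ E (max R ‖y‖)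
  have hderiv : ∀ x y : E, max R ‖y‖ < ‖x‖ →
      HasFDerivAt (fun y => segmentAction L (far y) y) (fderiv ℝ (L y) (y - x)) y := by
    intro x y hxy
    have hne : x ≠ y := by
      rintro rfl
      exact (le_max_right _ _).not_gt hxy
    have h : HasFDerivAt (fun y => segmentAction L x y) _ y :=
      (hvar (p := (x, y)) hne).comp (f := fun y => (x, y)) y (hasFDerivAt_prodMk_right x y)
    -- A fixed `x` remains distant for all `z` near `y`, so it can replace the varying `far z`.
    have hev : ∀ᶠ z in nhds y, max R ‖z‖ < ‖x‖ :=
      (continuous_const.max continuous_norm).continuousAt.eventually_lt continuousAt_const hxy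
    have h' := h.congr_of_eventuallyEq
      (hev.mono fun z hz => hconst z (far z) x (hfar z) hz)
    refine h'.congr_fderiv (ContinuousLinearMap.ext fun a => ?_)
    simp
  have hformula : ∀ y v : E, fderiv ℝ (fun y => segmentAction L (far y) y) y v = L y v := by
    intro y v
    have hhom := hL.homogeneous y trivial
    rcases eq_or_ne v 0 with rfl | hv
    · simpa using (hhom 0 0 le_rfl).symm
    have hv' : 0 < ‖v‖ := norm_pos_iff.2 hv
    -- This size makes `‖y - c • v‖` at least `R + ‖y‖ + 1`.
    set c : ℝ := (R + 2 * ‖y‖ + 1) / ‖v‖ with hc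
    have hc0 : 0 < c := by positivity
    have hcv : ‖c • v‖ = R + 2 * ‖y‖ + 1 := by
      rw [norm_smul, Real.norm_of_nonneg hc0.le, hc, div_mul_cancel₀ _ hv'.ne']
    have hfarv : max R ‖y‖ < ‖y - c • v‖ := by
      have h := norm_sub_norm_le (c • v) y
      rw [norm_sub_rev, hcv] at h
      have := norm_nonneg y
      exact max_lt (by linarith) (by linarith)
    rw [(hderiv _ y hfarv).fderiv, sub_sub_cancel]
    have hd : DifferentiableAt ℝ (L y) (c • v) := by
      have h := (hC2.contDiffAt (isOpen_snd_ne_zero.mem_nhds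
        (show ((y, c • v) : E × E).2 ≠ 0 from smul_ne_zero hc0.ne' hv))).differentiableAt
        two_ne_zero
      exact h.comp (f := fun w => (y, w)) (c • v)
        ((differentiableAt_const y).prodMk differentiableAt_id)
    -- Euler's identity: differentiate `s ↦ L y (s • v) = s * L y v` at `c` in two ways.
    have h₁ : HasDerivAt (fun s : ℝ => L y (s • v)) (fderiv ℝ (L y) (c • v) ((1 : ℝ) • v)) c :=
      hd.hasFDerivAt.comp_hasDerivAt c ((hasDerivAt_id c).smul_const v)
    have h₂ : HasDerivAt (fun s : ℝ => L y (s • v)) (1 * L y v) c := by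
      refine ((hasDerivAt_id c).mul_const (L y v)).congr_of_eventuallyEq ?_
      filter_upwards [lt_mem_nhds hc0] with s hs using hhom s v (le_of_lt hs)
    simpa using h₁.unique h₂
  refine ⟨fun y => segmentAction L (far y) y, ?_, fun x _ v => (hformula x v).symm⟩
  -- In finite dimension it suffices that `y ↦ L y v` is `C^2` for each fixed `v`.
  rw [contDiffOn_univ, show (3 : WithTop ℕ∞) = 2 + 1 by norm_num, contDiff_succ_iff_fderiv_apply]
  refine ⟨fun y => (hderiv (far y) y (hfar y)).differentiableAt, by simp, fun v => ?_⟩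
  simp only [hformula]
  rcases eq_or_ne v 0 with rfl | hv
  · have h0 : ∀ y, L y 0 = 0 := fun y => by simpa using hL.homogeneous y trivial 0 0 le_rfl
    simpa only [h0] using contDiff_const
  · rw [← contDiffOn_univ]
    exact hC2.comp (contDiff_id.prodMk contDiff_const).contDiffOn fun y _ => hv

end Segment

/-! ### Differences, gluing and extension by zero -/

section Extension

variable {E : Type*} [NormedAddCommGroup E] [NormedSpace ℝ E]

theorem IsFinslerMetricOn.isOneDensityOn {k : WithTop ℕ∞} {O : Set E} {F : E → E → ℝ}
    (hF : IsFinslerMetricOn k O F) : IsOneDensityOn k O F where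
  continuousOn := hF.continuousOn
  contDiffOn := hF.contDiffOn
  homogeneous x hx c v hc := by
    rcases hc.eq_or_lt with rfl | hc
    · simpa using ((hF.isMinkowskiNorm x hx).eq_zero_iff 0).2 rfl
    · exact (hF.isMinkowskiNorm x hx).homogeneous c v hc

theorem IsOneDensityOn.sub {k : WithTop ℕ∞} {O : Set E} {L₁ L₂ : E → E → ℝ}
    (h₁ : IsOneDensityOn k O L₁) (h₂ : IsOneDensityOn k O L₂) :
    IsOneDensityOn k O (fun x v => L₁ x v - L₂ x v) where
  continuousOn := h₁.continuousOn.sub h₂.continuousOn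
  contDiffOn := h₁.contDiffOn.sub h₂.contDiffOn
  homogeneous x hx c v hc := by
    rw [h₁.homogeneous x hx c v hc, h₂.homogeneous x hx c v hc, mul_sub]

theorem IsOneDensityOn.differentiableAt_right {O : Set E} (hO : IsOpen O) {L : E → E → ℝ}
    (h : IsOneDensityOn 2 O L) {x v : E} (hx : x ∈ O) (hv : v ≠ 0) :
    DifferentiableAt ℝ (L x) v :=
  ((h.contDiffOn.contDiffAt ((hO.prod isOpen_compl_singleton).mem_nhds
    (show (x, v) ∈ O ×ˢ {0}ᶜ from ⟨hx, hv⟩))).differentiableAt two_ne_zero).comp (f := fun w => (x, w)) v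
    ((differentiableAt_const x).prodMk differentiableAt_id)

theorem IsOneDensityOn.differentiableAt_left {O : Set E} (hO : IsOpen O) {L : E → E → ℝ}
    (h : IsOneDensityOn 2 O L) {x v : E} (hx : x ∈ O) (hv : v ≠ 0) :
    DifferentiableAt ℝ (fun y => L y v) x :=
  ((h.contDiffOn.contDiffAt ((hO.prod isOpen_compl_singleton).mem_nhds
    (show (x, v) ∈ O ×ˢ {0}ᶜ from ⟨hx, hv⟩))).differentiableAt two_ne_zero).comp
    (f := fun y => (y, v)) x
    (differentiableAt_id.prodMk (differentiableAt_const v))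

theorem IsProjectiveOn.sub {O : Set E} (hO : IsOpen O) {L₁ L₂ : E → E → ℝ}
    (h₁ : IsOneDensityOn 2 O L₁) (h₂ : IsOneDensityOn 2 O L₂)
    (hp₁ : IsProjectiveOn O L₁) (hp₂ : IsProjectiveOn O L₂) :
    IsProjectiveOn O (fun x v => L₁ x v - L₂ x v) := by
  intro x v hv t ht
  rw [fderiv_fun_sub (h₁.differentiableAt_left hO ht hv) (h₂.differentiableAt_left hO ht hv)]
  refine ((hp₁ x v hv t ht).sub (hp₂ x v hv t ht)).congr_of_eventuallyEq ?_
  have hcont : Continuous fun s : ℝ => x + s • v := by fun_prop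
  filter_upwards [hcont.continuousAt.eventually (hO.mem_nhds ht)] with s hs
  exact fderiv_fun_sub (h₁.differentiableAt_right hO hs hv) (h₂.differentiableAt_right hO hs hv)

/-- The Euler-Lagrange equations are local in the base point. -/
theorem IsProjectiveOn.congr_of_isOpen {U V : Set E} (hU : IsOpen U) (hUV : U ⊆ V)
    {L M : E → E → ℝ} (hM : IsProjectiveOn V M) (h : ∀ x ∈ U, L x = M x) :
    IsProjectiveOn U L := by
  intro x v hv t ht
  have hcont : Continuous fun s : ℝ => x + s • v := by fun_prop
  have heq : (fun y => L y v) =ᶠ[nhds (x + t • v)] fun y => M y v := by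
    filter_upwards [hU.mem_nhds ht] with y hy
    rw [h y hy]
  rw [heq.fderiv_eq]
  refine (hM x v hv t (hUV ht)).congr_of_eventuallyEq ?_
  filter_upwards [hcont.continuousAt.eventually (hU.mem_nhds ht)] with s hs
  exact congrArg (fun N : E → ℝ => fderiv ℝ N v) (h _ hs)

theorem IsProjectiveOn.union {U V : Set E} {L : E → E → ℝ}
    (hU : IsProjectiveOn U L) (hV : IsProjectiveOn V L) : IsProjectiveOn (U ∪ V) L :=
  fun x v hv t ht => ht.elim (hU x v hv t) (hV x v hv t)

theorem isProjectiveOn_zero (O : Set E) : IsProjectiveOn O (fun _ _ => (0 : ℝ)) := by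
  intro x v _ t _
  simpa using hasDerivAt_const t (0 : E →L[ℝ] ℝ)

theorem IsOneDensityOn.congr {k : WithTop ℕ∞} {U V : Set E} (hUV : U ⊆ V) {L M : E → E → ℝ}
    (hM : IsOneDensityOn k V M) (h : ∀ x ∈ U, L x = M x) : IsOneDensityOn k U L where
  continuousOn := (hM.continuousOn.mono (Set.prod_mono_left hUV)).congr fun p hp =>
    congrFun (h p.1 hp.1) p.2
  contDiffOn := (hM.contDiffOn.mono (Set.prod_mono_left hUV)).congr fun p hp =>
    congrFun (h p.1 hp.1) p.2
  homogeneous x hx c v hc := by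
    rw [h x hx]
    exact hM.homogeneous x (hUV hx) c v hc

theorem IsOneDensityOn.union {k : WithTop ℕ∞} {U V : Set E} (hU : IsOpen U) (hV : IsOpen V)
    {L : E → E → ℝ} (h₁ : IsOneDensityOn k U L) (h₂ : IsOneDensityOn k V L) :
    IsOneDensityOn k (U ∪ V) L where
  continuousOn := by
    rw [Set.union_prod]
    exact h₁.continuousOn.union_of_isOpen h₂.continuousOn (hU.prod isOpen_univ)
      (hV.prod isOpen_univ)
  contDiffOn := by
    rw [Set.union_prod]
    exact h₁.contDiffOn.union_of_isOpen h₂.contDiffOn (hU.prod isOpen_compl_singleton)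
      (hV.prod isOpen_compl_singleton)
  homogeneous x hx c v hc := hx.elim (fun hx => h₁.homogeneous x hx c v hc)
    fun hx => h₂.homogeneous x hx c v hc

theorem isOneDensityOn_zero (k : WithTop ℕ∞) (O : Set E) :
    IsOneDensityOn k O (fun _ _ => (0 : ℝ)) where
  continuousOn := continuousOn_const
  contDiffOn := contDiffOn_const
  homogeneous := by simp

end Extension

/-- The open sets `O` and `Kᶜ` cover the space, and the extension of `L` by zero is a projective
density on each, hence globally. -/
theorem isDifferentialOfC3On_of_isCompact {E : Type*} [NormedAddCommGroup E] [NormedSpace ℝ E]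
    [FiniteDimensional ℝ E] (hrank : 1 < Module.rank ℝ E) {O : Set E} (hO : IsOpen O)
    {L : E → E → ℝ} (hL : IsOneDensityOn 2 O L) (hproj : IsProjectiveOn O L) {K : Set E}
    (hK : IsCompact K) (hKO : K ⊆ O) (hsupp : ∀ x ∈ O \ K, ∀ v, L x v = 0) :
    IsDifferentialOfC3On O L := by
  classical
  let M : E → E → ℝ := fun x => if x ∈ O then L x else fun _ => 0
  have hMO : ∀ x ∈ O, M x = L x := fun x hx => if_pos hx
  have hMK : ∀ x ∈ Kᶜ, M x = fun _ => 0 := by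
    intro x hx
    by_cases hxO : x ∈ O
    · rw [hMO x hxO]
      exact funext (hsupp x ⟨hxO, hx⟩)
    · exact if_neg hxO
  have huniv : O ∪ Kᶜ = Set.univ := by
    rw [Set.eq_univ_iff_forall]
    intro x
    by_cases hx : x ∈ K
    · exact Or.inl (hKO hx)
    · exact Or.inr hx
  have hKc : IsOpen Kᶜ := hK.isClosed.isOpen_compl
  have hMd : IsOneDensityOn 2 Set.univ M := huniv ▸
    (hL.congr subset_rfl hMO).union hO hKc
      ((isOneDensityOn_zero 2 Kᶜ).congr subset_rfl hMK)
  have hMp : IsProjectiveOn Set.univ M := huniv ▸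
    (hproj.congr_of_isOpen hO subset_rfl hMO).union
      ((isProjectiveOn_zero Kᶜ).congr_of_isOpen hKc subset_rfl hMK)
  obtain ⟨R, hR, hKR⟩ := hK.isBounded.exists_pos_norm_le
  obtain ⟨f, hf, hfM⟩ := hMd.isDifferentialOfC3On_univ hrank hMp hR.le fun x hx v =>
    congrFun (hMK x fun hxK => (hKR x hxK).not_gt hx) v
  refine ⟨f, hf.mono (Set.subset_univ _), fun x hx v => ?_⟩
  rw [← hMO x hx]
  exact hfM x trivial v

theorem mainTheorem8 (n : ℕ) (hn : 2 ≤ n) :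
    (∀ L : EuclideanSpace ℝ (Fin n) → EuclideanSpace ℝ (Fin n) → ℝ,
      IsOneDensityOn 2 Set.univ L →
      IsProjectiveOn Set.univ L →
      (∃ K : Set (EuclideanSpace ℝ (Fin n)), IsCompact K ∧ ∀ x, x ∉ K → ∀ v, L x v = 0) →
      IsDifferentialOfC3On Set.univ L) ∧
    (∀ (O : Set (EuclideanSpace ℝ (Fin n))), IsOpen O → Convex ℝ O →
      ∀ F₁ F₂ : EuclideanSpace ℝ (Fin n) → EuclideanSpace ℝ (Fin n) → ℝ,
      IsFinslerMetricOn 2 O F₁ → IsProjectiveOn O F₁ →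
      IsFinslerMetricOn 2 O F₂ → IsProjectiveOn O F₂ →
      (∃ K : Set (EuclideanSpace ℝ (Fin n)), IsCompact K ∧ K ⊆ O ∧
        ∀ x ∈ O \ K, ∀ v, F₁ x v = F₂ x v) →
      IsDifferentialOfC3On O (fun x v => F₁ x v - F₂ x v)) := by
  have hrank : 1 < Module.rank ℝ (EuclideanSpace ℝ (Fin n)) := by
    rw [← Module.finrank_eq_rank, finrank_euclideanSpace_fin]
    exact_mod_cast hn
  refine ⟨fun L hL hproj ⟨K, hK, hsupp⟩ => ?_,
    fun O hO _ F₁ F₂ hF₁ hp₁ hF₂ hp₂ ⟨K, hK, hKO, heq⟩ => ?_⟩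
  · exact isDifferentialOfC3On_of_isCompact hrank isOpen_univ hL hproj hK (Set.subset_univ K)
      fun x hx v => hsupp x hx.2 v
  · exact isDifferentialOfC3On_of_isCompact hrank hO
      (hF₁.isOneDensityOn.sub hF₂.isOneDensityOn)
      (IsProjectiveOn.sub hO hF₁.isOneDensityOn hF₂.isOneDensityOn hp₁ hp₂) hK hKO
      fun x hx v => sub_eq_zero.2 (heq x hx v)
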